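/- For $\nu\in\mathbb{R}$ and $y>0$ let $K_\nu(y)=\int_0^\infty \mathrm{e}^{-y\cosh t}\cosh(\nu t)\,\mathrm{d}t$ be the modified Bessel function of the second kind. For $r>2$, $\theta\in\mathbb{R}$, $\sigma>0$, $\mu\in\mathbb{R}$, let $p$ be the $\mathrm{VG}(r,\theta,\sigma,\mu)$ density $$p(x)=\frac{1}{\sigma\sqrt{\pi}\,\Gamma(\frac r2)}\,\mathrm{e}^{\frac{\theta}{\sigma^2}(x-\mu)}\bigg(\frac{|x-\mu|}{2\sqrt{\theta^2+\sigma^2}}\bigg)^{\frac{r-1}{2}}K_{\frac{r-1}{2}}\bigg(\frac{\sqrt{\theta^2+\sigma^2}}{\sigma^2}|x-\mu|\bigg),\qquad x\neq\mu,$$ with $p(\mu):=\lim_{x\to\mu}p(x)$. Then, for all $x\in\mathbb{R}$, $$p(x)\leq \frac{\Gamma(\frac{r-1}{2})}{2\sigma\sqrt{\pi}\,\Gamma(\frac{r}{2})}\bigg(\frac{\sigma^2}{\theta^2+\sigma^2}\bigg)^{\frac{r-1}{2}}\mathrm{e}^{\frac{\theta^2}{\sigma^2}(r-2)}. \tag{1}$$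 If moreover $r>3$ and $\theta\neq0$, then, for all $x\in\mathbb{R}$, $$p(x)<\frac{1}{\sigma\sqrt{\pi}\,\Gamma(\frac r2)}\,\mathrm{e}^{\frac{\theta^2}{\sigma^2}(r-2)}\bigg(\frac{|\theta|(r-3)}{2\sqrt{\theta^2+\sigma^2}}\bigg)^{\frac{r-1}{2}}K_{\frac{r-1}{2}}\bigg(\frac{|\theta|\sqrt{\theta^2+\sigma^2}}{\sigma^2}(r-3)\bigg), \tag{2}$$ and this bound improves on (1): the right-hand side of (2) is strictly less than the right-hand side of (1). -/

import Mathlib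

noncomputable section

/-- The modified Bessel function of the second kind of real order `ν`, for `x > 0`:
`K_ν(x) = ∫₀^∞ exp(-x cosh t) cosh(ν t) dt`. -/
def besselK (ν x : ℝ) : ℝ :=
  ∫ t in Set.Ioi (0 : ℝ), Real.exp (-x * Real.cosh t) * Real.cosh (ν * t)

/-- The closed form of the variance-gamma density, meaningful for `x ≠ μ`
(at `x = μ` it reads `0 · ∞` when `r > 1`). -/
def vgFormula (r θ σ μ x : ℝ) : ℝ :=
  1 / (σ * Real.sqrt Real.pi * Real.Gamma (r / 2)) * Real.exp (θ / σ ^ 2 * (x - μ))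
    * (|x - μ| / (2 * Real.sqrt (θ ^ 2 + σ ^ 2))) ^ ((r - 1) / 2)
    * besselK ((r - 1) / 2) (Real.sqrt (θ ^ 2 + σ ^ 2) / σ ^ 2 * |x - μ|)

open scoped Classical in
/-- The variance-gamma density `VG(r, θ, σ, μ)`. At `x = μ` it takes the limiting value of the
closed form as `x → μ`; this limit is finite for `r > 1`. (For `r ≤ 1` the closed form
is singular at `μ`, and the value at that one point carries no meaning.) -/
def vgDensity (r θ σ μ x : ℝ) : ℝ :=
  if x = μ then Filter.limUnder (nhdsWithin μ {μ}ᶜ) (vgFormula r θ σ μ) else vgFormula r θ σ μ x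

end

open MeasureTheory Set Filter Topology

/-! Put s = √(θ² + σ²), ν = (r - 1)/2, a = |θ|/s < 1 and y = s|x - μ|/σ². Off μ the density is at
most C · e^{ay} y^ν K_ν(y), and at μ it is the limit as y → 0.

The factor y^ν K_ν(y) is strictly decreasing, with limit 2^{ν-1} Γ(ν) at 0. The derivative of the
full product has the sign of a K_ν - K_{ν-1}, so its monotonicity is governed by the ratio
K_{ν-1}/K_ν. The quadratic inequalities `mul_besselK_sq_le` and `mul_besselK_sq_ge` bound this ratio
from both sides: the product decreases on [b, ∞) and increases on (0, b'], where b = |θ|s(r - 2)/σ²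
and b' = |θ|s(r - 3)/σ² (the latter when r > 3 and θ ≠ 0).

So only y ≤ b matters, where e^{ay} ≤ e^{ab} = e^{θ²(r-2)/σ²}. Bounding y^ν K_ν by its limit at 0
gives (1); bounding it by its value at b' gives (2), which is smaller by strict monotonicity. -/

/-! ### Integrability and decay of the Bessel integrands -/

theorem one_add_sq_div_two_le_cosh (t : ℝ) : 1 + t ^ 2 / 2 ≤ Real.cosh t := by
  have h1 : |t / 2| ≤ |Real.sinh (t / 2)| := by
    rw [Real.abs_sinh]
    exact Real.self_le_sinh_iff.2 (abs_nonneg _)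
  have h2 := sq_le_sq.2 h1
  have h3 := Real.cosh_two_mul (t / 2)
  have h4 := Real.cosh_sq (t / 2)
  rw [mul_div_cancel₀ t two_ne_zero] at h3
  linarith

theorem integrable_exp_neg_mul_cosh_mul_exp {y : ℝ} (hy : 0 < y) (c : ℝ) :
    Integrable (fun t : ℝ => Real.exp (-y * Real.cosh t) * Real.exp (c * t)) := by
  -- Half of the Gaussian decay y t²/2 from `cosh` absorbs c t by completing the square; the other
  -- half remains.
  have hg : Integrable (fun t : ℝ => Real.exp (c ^ 2 / y) * Real.exp (-(y / 4) * t ^ 2)) :=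
    (integrable_exp_neg_mul_sq (by positivity)).const_mul _
  refine hg.mono' (by fun_prop) (ae_of_all _ fun t => ?_)
  rw [Real.norm_of_nonneg (by positivity), ← Real.exp_add, ← Real.exp_add]
  apply Real.exp_le_exp.2
  have h1 : 1 + t ^ 2 / 2 ≤ Real.cosh t := one_add_sq_div_two_le_cosh t
  have h2 : c * t ≤ c ^ 2 / y + y / 4 * t ^ 2 := by
    have : c ^ 2 / y + y / 4 * t ^ 2 - c * t = (c - y / 2 * t) ^ 2 / y := by
      field_simp
      ring
    have h3 : 0 ≤ (c - y / 2 * t) ^ 2 / y := by positivity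
    linarith
  nlinarith

theorem integrable_exp_neg_mul_cosh_mul_cosh {y : ℝ} (hy : 0 < y) (ν : ℝ) :
    Integrable (fun t : ℝ => Real.exp (-y * Real.cosh t) * Real.cosh (ν * t)) := by
  have h := ((integrable_exp_neg_mul_cosh_mul_exp hy ν).add
    (integrable_exp_neg_mul_cosh_mul_exp hy (-ν))).div_const 2
  refine h.congr (ae_of_all _ fun t => ?_)
  simp only [Pi.add_apply, Real.cosh_eq (ν * t), neg_mul]
  ring

theorem integrable_exp_neg_mul_cosh_mul_cosh_mul_cosh {y : ℝ} (hy : 0 < y) (ν : ℝ) :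
    Integrable (fun t : ℝ => Real.exp (-y * Real.cosh t) * Real.cosh (ν * t) * Real.cosh t) := by
  have h := ((integrable_exp_neg_mul_cosh_mul_cosh hy (ν + 1)).add
    (integrable_exp_neg_mul_cosh_mul_cosh hy (ν - 1))).div_const 2
  refine h.congr (ae_of_all _ fun t => ?_)
  simp only [Pi.add_apply, add_mul, sub_mul, one_mul, Real.cosh_add, Real.cosh_sub]
  ring

theorem integral_exp_neg_mul_cosh_mul_cosh_mul_cosh {y : ℝ} (hy : 0 < y) (ν : ℝ) :
    ∫ t in Ioi (0 : ℝ), Real.exp (-y * Real.cosh t) * Real.cosh (ν * t) * Real.cosh t =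
      (besselK (ν + 1) y + besselK (ν - 1) y) / 2 := by
  unfold besselK
  rw [← integral_add (integrable_exp_neg_mul_cosh_mul_cosh hy _).integrableOn
    (integrable_exp_neg_mul_cosh_mul_cosh hy _).integrableOn, ← integral_div]
  congr 1 with t
  simp only [add_mul, sub_mul, one_mul, Real.cosh_add, Real.cosh_sub]
  ring

theorem besselK_pos {y : ℝ} (hy : 0 < y) (ν : ℝ) : 0 < besselK ν y := by
  unfold besselK
  rw [setIntegral_pos_iff_support_of_nonneg_ae]
  · have : Function.support (fun t : ℝ => Real.exp (-y * Real.cosh t) * Real.cosh (ν * t)) = univ := by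
      ext t
      simp [(Real.cosh_pos _).ne']
    rw [this, univ_inter]
    simp
  · exact ae_of_all _ fun t => by
      have := Real.cosh_pos (ν * t)
      simp only [Pi.zero_apply]
      positivity
  · exact (integrable_exp_neg_mul_cosh_mul_cosh hy _).integrableOn

theorem integrable_exp_neg_mul_cosh_mul_sinh_mul_sinh {y : ℝ} (hy : 0 < y) (ν : ℝ) :
    Integrable (fun t : ℝ => Real.exp (-y * Real.cosh t) * (Real.sinh t * Real.sinh (ν * t))) := by
  have h := ((integrable_exp_neg_mul_cosh_mul_cosh hy (ν + 1)).sub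
    (integrable_exp_neg_mul_cosh_mul_cosh hy (ν - 1))).div_const 2
  refine h.congr (ae_of_all _ fun t => ?_)
  simp only [Pi.sub_apply, add_mul, sub_mul, one_mul, Real.cosh_add, Real.cosh_sub]
  ring

theorem tendsto_exp_neg_mul_cosh_mul_exp {y : ℝ} (hy : 0 < y) (c : ℝ) :
    Tendsto (fun t : ℝ => Real.exp (-y * Real.cosh t) * Real.exp (c * t)) atTop (𝓝 0) := by
  -- Completing the square with c + 1 instead of c leaves a spare factor e^{-t}.
  have hlim : Tendsto (fun t : ℝ => Real.exp ((c + 1) ^ 2 / (2 * y)) * Real.exp (-t)) atTop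
      (𝓝 0) := by
    simpa using (Real.tendsto_exp_neg_atTop_nhds_zero).const_mul (Real.exp ((c + 1) ^ 2 / (2 * y)))
  refine squeeze_zero (fun t => by positivity) (fun t => ?_) hlim
  rw [← Real.exp_add, ← Real.exp_add]
  apply Real.exp_le_exp.2
  have h1 : 1 + t ^ 2 / 2 ≤ Real.cosh t := one_add_sq_div_two_le_cosh t
  have h2 : (c + 1) * t ≤ (c + 1) ^ 2 / (2 * y) + y / 2 * t ^ 2 := by
    have : (c + 1) ^ 2 / (2 * y) + y / 2 * t ^ 2 - (c + 1) * t = (c + 1 - y * t) ^ 2 / (2 * y) := by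
      field_simp
      ring
    have h3 : 0 ≤ (c + 1 - y * t) ^ 2 / (2 * y) := by positivity
    linarith
  nlinarith

/-! ### Recurrence and derivative of K_ν -/

/-- Integrate the t-derivative of e^{-y cosh t} sinh(νt) over (0, ∞); both boundary terms vanish. -/
theorem besselK_recurrence {y : ℝ} (hy : 0 < y) (ν : ℝ) :
    y * (besselK (ν + 1) y - besselK (ν - 1) y) = 2 * ν * besselK ν y := by
  have hder : ∀ t ∈ Ici (0 : ℝ), HasDerivAt
      (fun t : ℝ => Real.exp (-y * Real.cosh t) * Real.sinh (ν * t))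
      (ν * (Real.exp (-y * Real.cosh t) * Real.cosh (ν * t)) -
        y * (Real.exp (-y * Real.cosh t) * (Real.sinh t * Real.sinh (ν * t)))) t := by
    intro t _
    have h1 := ((Real.hasDerivAt_cosh t).const_mul (-y)).exp
    have h2 := ((hasDerivAt_id t).const_mul ν).sinh
    refine (h1.mul h2).congr_deriv ?_
    simp only [id]
    ring
  have hi1 := ((integrable_exp_neg_mul_cosh_mul_cosh hy ν).const_mul ν).integrableOn (s := Ioi 0)
  have hi2 := ((integrable_exp_neg_mul_cosh_mul_sinh_mul_sinh hy ν).const_mul y).integrableOn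
    (s := Ioi 0)
  have hlim : Tendsto (fun t : ℝ => Real.exp (-y * Real.cosh t) * Real.sinh (ν * t)) atTop
      (𝓝 0) := by
    have h := ((tendsto_exp_neg_mul_cosh_mul_exp hy ν).sub
      (tendsto_exp_neg_mul_cosh_mul_exp hy (-ν))).div_const 2
    simp only [sub_zero, zero_div] at h
    refine h.congr fun t => ?_
    rw [Real.sinh_eq (ν * t), neg_mul ν]
    ring
  have key := integral_Ioi_of_hasDerivAt_of_tendsto' hder (hi1.sub hi2) hlim
  rw [integral_sub hi1 hi2, integral_const_mul, integral_const_mul] at key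
  have hs : ∫ t in Ioi (0 : ℝ), Real.exp (-y * Real.cosh t) * (Real.sinh t * Real.sinh (ν * t)) =
      (besselK (ν + 1) y - besselK (ν - 1) y) / 2 := by
    unfold besselK
    rw [← integral_sub (integrable_exp_neg_mul_cosh_mul_cosh hy _).integrableOn
      (integrable_exp_neg_mul_cosh_mul_cosh hy _).integrableOn, ← integral_div]
    congr 1 with t
    simp only [add_mul, sub_mul, one_mul, Real.cosh_add, Real.cosh_sub]
    ring
  rw [hs] at key
  change ν * besselK ν y - _ = _ at key
  simp only [mul_zero, Real.sinh_zero, sub_zero] at key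
  linarith

theorem hasDerivAt_besselK {y : ℝ} (hy : 0 < y) (ν : ℝ) :
    HasDerivAt (besselK ν) (-((besselK (ν + 1) y + besselK (ν - 1) y) / 2)) y := by
  have h := (hasDerivAt_integral_of_dominated_loc_of_deriv_le (μ := volume.restrict (Ioi (0 : ℝ)))
    (F := fun x t => Real.exp (-x * Real.cosh t) * Real.cosh (ν * t))
    (F' := fun x t => -(Real.exp (-x * Real.cosh t) * Real.cosh (ν * t) * Real.cosh t))
    (bound := fun t => Real.exp (-(y / 2) * Real.cosh t) * Real.cosh (ν * t) * Real.cosh t)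
    (x₀ := y) (s := Ioi (y / 2)) (Ioi_mem_nhds (by linarith))
    (Eventually.of_forall fun x => by fun_prop)
    (integrable_exp_neg_mul_cosh_mul_cosh hy ν).integrableOn (by fun_prop)
    (ae_of_all _ fun t x hx => ?_)
    (integrable_exp_neg_mul_cosh_mul_cosh_mul_cosh (half_pos hy) ν).integrableOn
    (ae_of_all _ fun t x _ => ?_)).2
  · rw [integral_neg, integral_exp_neg_mul_cosh_mul_cosh_mul_cosh hy] at h
    exact h
  · have h1 := Real.cosh_pos (ν * t)
    have h2 := Real.cosh_pos t
    rw [norm_neg, Real.norm_of_nonneg (by positivity)]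
    gcongr
    exact (mem_Ioi.1 hx).le
  · have h1 := (((hasDerivAt_id x).neg.mul_const (Real.cosh t)).exp).mul_const (Real.cosh (ν * t))
    refine h1.congr_deriv ?_
    simp only [id, Pi.neg_apply]
    ring

/-! ### Bounds for the ratio K_{ν-1}/K_ν -/

/-- Cauchy–Schwarz via a discriminant: the quadratic in x has a nonnegative integrand because
cosh((ν+1)t) cosh((ν-1)t) = cosh²(νt) + sinh² t. -/
theorem besselK_sq_le {y : ℝ} (hy : 0 < y) (ν : ℝ) :
    besselK ν y ^ 2 ≤ besselK (ν + 1) y * besselK (ν - 1) y := by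
  have h : ∀ x : ℝ, 0 ≤ besselK (ν + 1) y * (x * x) + 2 * besselK ν y * x + besselK (ν - 1) y := by
    intro x
    have i1 := (integrable_exp_neg_mul_cosh_mul_cosh hy (ν + 1)).integrableOn (s := Ioi 0)
    have i2 := (integrable_exp_neg_mul_cosh_mul_cosh hy ν).integrableOn (s := Ioi 0)
    have i3 := (integrable_exp_neg_mul_cosh_mul_cosh hy (ν - 1)).integrableOn (s := Ioi 0)
    have he : besselK (ν + 1) y * (x * x) + 2 * besselK ν y * x + besselK (ν - 1) y =
        ∫ t in Ioi (0 : ℝ), (Real.exp (-y * Real.cosh t) * Real.cosh ((ν + 1) * t) * (x * x) +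
          Real.exp (-y * Real.cosh t) * Real.cosh (ν * t) * (2 * x) +
          Real.exp (-y * Real.cosh t) * Real.cosh ((ν - 1) * t)) := by
      rw [integral_add ((i1.mul_const _).fun_add (i2.mul_const _)) i3,
        integral_add (i1.mul_const _) (i2.mul_const _), integral_mul_const, integral_mul_const]
      unfold besselK
      ring
    rw [he]
    refine integral_nonneg fun t => ?_
    have hc : Real.cosh (ν * t) ^ 2 ≤ Real.cosh ((ν + 1) * t) * Real.cosh ((ν - 1) * t) := by
      simp only [add_mul, sub_mul, one_mul, Real.cosh_add, Real.cosh_sub]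
      nlinarith [Real.cosh_sq t, Real.cosh_sq (ν * t), sq_nonneg (Real.sinh t)]
    have hp := Real.cosh_pos ((ν + 1) * t)
    have hq : 0 ≤ Real.cosh ((ν + 1) * t) * (x * x) + Real.cosh (ν * t) * (2 * x) +
        Real.cosh ((ν - 1) * t) := by
      refine nonneg_of_mul_nonneg_right (?_ : 0 ≤ Real.cosh ((ν + 1) * t) * _) hp
      nlinarith [sq_nonneg (Real.cosh ((ν + 1) * t) * x + Real.cosh (ν * t))]
    have : 0 ≤ Real.exp (-y * Real.cosh t) * (Real.cosh ((ν + 1) * t) * (x * x) +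
      Real.cosh (ν * t) * (2 * x) + Real.cosh ((ν - 1) * t)) := by positivity
    simp only [Pi.zero_apply]
    linarith
  have := discrim_le_zero h
  unfold discrim at this
  linarith

/-- A weighted form of Chebyshev's integral inequality. -/
theorem integral_mul_integral_le_of_antivary {α : Type*} [MeasurableSpace α] {m : Measure α}
    {A B C : α → ℝ} (hA : Integrable A m) (hB : Integrable B m)
    (hAC : Integrable (fun t => A t * C t) m) (hBC : Integrable (fun t => B t * C t) m)
    (h : ∀ᵐ s ∂m, ∀ᵐ t ∂m, (A s * B t - A t * B s) * (C s - C t) ≤ 0) :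
    (∫ t, A t * C t ∂m) * ∫ t, B t ∂m ≤ (∫ t, A t ∂m) * ∫ t, B t * C t ∂m := by
  -- Integrating the hypothesis in t and then in s yields twice the desired difference; iterated
  -- integrals suffice, without Fubini.
  have inner : ∀ᵐ s ∂m, A s * C s * (∫ t, B t ∂m) - A s * (∫ t, B t * C t ∂m)
      - B s * C s * (∫ t, A t ∂m) + B s * (∫ t, A t * C t ∂m) ≤ 0 := by
    filter_upwards [h] with s hs
    have := integral_nonpos_of_ae hs
    have he : ∫ t, (A s * B t - A t * B s) * (C s - C t) ∂m =
        ∫ t, (A s * C s * B t - A s * (B t * C t) - B s * C s * A t + B s * (A t * C t)) ∂m := by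
      congr 1 with t
      ring
    rw [he, integral_add (((hB.const_mul _).sub' (hBC.const_mul _)).sub' (hA.const_mul _))
      (hAC.const_mul _), integral_sub ((hB.const_mul _).sub' (hBC.const_mul _)) (hA.const_mul _),
      integral_sub (hB.const_mul _) (hBC.const_mul _)] at this
    simpa only [integral_const_mul] using this
  have outer := integral_nonpos_of_ae inner
  rw [integral_add (((hAC.mul_const _).sub' (hA.mul_const _)).sub' (hBC.mul_const _))
      (hB.mul_const _), integral_sub ((hAC.mul_const _).sub' (hA.mul_const _)) (hBC.mul_const _),
      integral_sub (hAC.mul_const _) (hA.mul_const _)] at outer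
  simp only [integral_mul_const] at outer
  linarith

/-- By product-to-sum, it suffices to compare squared arguments, which differ by (2ν - 1)(s² - t²)
in both cases. -/
theorem cosh_mul_cosh_le_cosh_mul_cosh {ν s t : ℝ} (hν : 1 / 2 ≤ ν) (ht : 0 ≤ t) (hts : t ≤ s) :
    Real.cosh ((ν - 1) * s) * Real.cosh (ν * t) ≤ Real.cosh ((ν - 1) * t) * Real.cosh (ν * s) := by
  have hst : 0 ≤ (2 * ν - 1) * ((s - t) * (s + t)) :=
    mul_nonneg (by linarith) (mul_nonneg (by linarith) (by linarith))
  have h1 : Real.cosh ((ν - 1) * s + ν * t) ≤ Real.cosh ((ν - 1) * t + ν * s) :=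
    Real.cosh_le_cosh.2 (sq_le_sq.1 (by nlinarith))
  have h2 : Real.cosh ((ν - 1) * s - ν * t) ≤ Real.cosh ((ν - 1) * t - ν * s) :=
    Real.cosh_le_cosh.2 (sq_le_sq.1 (by nlinarith))
  rw [Real.cosh_add, Real.cosh_add] at h1
  rw [Real.cosh_sub, Real.cosh_sub] at h2
  linarith

/-- Chebyshev's inequality applies since cosh((ν-1)t)/cosh(νt) decreases while cosh t increases. The
recurrence then eliminates K_{ν+1} and K_{ν-2}. -/
theorem mul_besselK_sq_le {y ν : ℝ} (hy : 0 < y) (hν : 1 / 2 ≤ ν) :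
    y * besselK ν y ^ 2 ≤
      y * besselK (ν - 1) y ^ 2 + (2 * ν - 1) * (besselK (ν - 1) y * besselK ν y) := by
  have key := integral_mul_integral_le_of_antivary (m := volume.restrict (Ioi (0 : ℝ)))
    (A := fun t => Real.exp (-y * Real.cosh t) * Real.cosh ((ν - 1) * t))
    (B := fun t => Real.exp (-y * Real.cosh t) * Real.cosh (ν * t)) (C := Real.cosh)
    (integrable_exp_neg_mul_cosh_mul_cosh hy _).integrableOn
    (integrable_exp_neg_mul_cosh_mul_cosh hy _).integrableOn
    (integrable_exp_neg_mul_cosh_mul_cosh_mul_cosh hy _).integrableOn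
    (integrable_exp_neg_mul_cosh_mul_cosh_mul_cosh hy _).integrableOn (by
      filter_upwards [ae_restrict_mem measurableSet_Ioi] with s hs
      filter_upwards [ae_restrict_mem measurableSet_Ioi] with t ht
      rw [mem_Ioi] at hs ht
      have e : 0 ≤ Real.exp (-y * Real.cosh s) * Real.exp (-y * Real.cosh t) := by positivity
      rcases le_total t s with hts | hst
      · have h1 := mul_le_mul_of_nonneg_left (cosh_mul_cosh_le_cosh_mul_cosh hν ht.le hts) e
        have h2 : Real.cosh t ≤ Real.cosh s :=
          Real.cosh_le_cosh.2 (by rwa [abs_of_pos ht, abs_of_pos hs])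
        exact mul_nonpos_of_nonpos_of_nonneg (by linarith) (by linarith)
      · have h1 := mul_le_mul_of_nonneg_left (cosh_mul_cosh_le_cosh_mul_cosh hν hs.le hst) e
        have h2 : Real.cosh s ≤ Real.cosh t :=
          Real.cosh_le_cosh.2 (by rwa [abs_of_pos ht, abs_of_pos hs])
        exact mul_nonpos_of_nonneg_of_nonpos (by linarith) (by linarith))
  rw [integral_exp_neg_mul_cosh_mul_cosh_mul_cosh hy,
    integral_exp_neg_mul_cosh_mul_cosh_mul_cosh hy] at key
  change _ * besselK ν y ≤ besselK (ν - 1) y * _ at key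
  have r1 := besselK_recurrence hy ν
  have r2 := besselK_recurrence hy (ν - 1)
  rw [sub_add_cancel] at key r2
  have k := mul_le_mul_of_nonneg_left key hy.le
  have r1' := congrArg (· * besselK (ν - 1) y) r1
  have r2' := congrArg (· * besselK ν y) r2
  linarith

/-- This is `besselK_sq_le` at order ν - 1, with K_{ν-2} eliminated by the recurrence. -/
theorem mul_besselK_sq_ge {y : ℝ} (hy : 0 < y) (ν : ℝ) :
    y * besselK (ν - 1) y ^ 2 + 2 * (ν - 1) * (besselK (ν - 1) y * besselK ν y) ≤
      y * besselK ν y ^ 2 := by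
  have h := besselK_sq_le hy (ν - 1)
  have r2 := besselK_recurrence hy (ν - 1)
  rw [sub_add_cancel] at h r2
  have k := mul_le_mul_of_nonneg_left h hy.le
  have r2' := congrArg (· * besselK ν y) r2
  linarith

theorem mul_besselK_le_besselK_sub_one {a y ν : ℝ} (hν : 1 / 2 ≤ ν)
    (hy : 0 < y) (h : a * (2 * ν - 1) ≤ y * (1 - a ^ 2)) :
    a * besselK ν y ≤ besselK (ν - 1) y := by
  by_contra! hlt
  have hP := besselK_pos hy (ν - 1)
  have hQ := besselK_pos hy ν
  have k := mul_besselK_sq_le hy hν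
  set P := besselK (ν - 1) y
  set Q := besselK ν y
  have h1 : P ^ 2 < (a * Q) ^ 2 := by gcongr
  have h2 := mul_lt_mul_of_pos_left h1 hy
  have h3 := mul_le_mul_of_nonneg_right h (sq_nonneg Q)
  have h4 : (2 * ν - 1) * (P * Q) ≤ (2 * ν - 1) * (a * Q * Q) :=
    mul_le_mul_of_nonneg_left (by gcongr) (by linarith)
  linarith

theorem besselK_sub_one_le_mul_besselK {a y ν : ℝ} (hν : 1 ≤ ν) (ha0 : 0 ≤ a)
    (hy : 0 < y) (h : y * (1 - a ^ 2) ≤ 2 * a * (ν - 1)) :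
    besselK (ν - 1) y ≤ a * besselK ν y := by
  by_contra! hlt
  have hP := besselK_pos hy (ν - 1)
  have hQ := besselK_pos hy ν
  have k := mul_besselK_sq_ge hy ν
  set P := besselK (ν - 1) y
  set Q := besselK ν y
  have h1 : (a * Q) ^ 2 < P ^ 2 := by gcongr
  have h2 := mul_lt_mul_of_pos_left h1 hy
  have h3 := mul_le_mul_of_nonneg_right h (sq_nonneg Q)
  have h4 : 2 * (ν - 1) * (a * Q * Q) ≤ 2 * (ν - 1) * (P * Q) :=
    mul_le_mul_of_nonneg_left (by gcongr) (by linarith)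
  linarith

/-! ### Monotonicity of y^ν K_ν(y) and e^{ay} y^ν K_ν(y) -/

theorem hasDerivAt_rpow_mul_besselK {y : ℝ} (hy : 0 < y) (ν : ℝ) :
    HasDerivAt (fun y => y ^ ν * besselK ν y) (-(y ^ ν * besselK (ν - 1) y)) y := by
  refine ((Real.hasDerivAt_rpow_const (Or.inl hy.ne')).mul (hasDerivAt_besselK hy ν)).congr_deriv ?_
  have r := besselK_recurrence hy ν
  have e : y ^ ν = y ^ (ν - 1) * y := by
    rw [← Real.rpow_add_one hy.ne', sub_add_cancel]
  rw [e]
  linear_combination (-(y ^ (ν - 1)) / 2) * r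

theorem hasDerivAt_exp_mul_rpow_mul_besselK {y : ℝ} (hy : 0 < y) (a ν : ℝ) :
    HasDerivAt (fun y => Real.exp (a * y) * (y ^ ν * besselK ν y))
      (Real.exp (a * y) * y ^ ν * (a * besselK ν y - besselK (ν - 1) y)) y := by
  refine (((hasDerivAt_id y).const_mul a).exp.mul
    (hasDerivAt_rpow_mul_besselK hy ν)).congr_deriv ?_
  simp only [id]
  ring

theorem strictAntiOn_rpow_mul_besselK (ν : ℝ) :
    StrictAntiOn (fun y => y ^ ν * besselK ν y) (Ioi 0) := by
  refine strictAntiOn_of_hasDerivWithinAt_neg (convex_Ioi 0)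
    (fun y hy => (hasDerivAt_rpow_mul_besselK hy ν).continuousAt.continuousWithinAt)
    (f' := fun y => -(y ^ ν * besselK (ν - 1) y)) (fun y hy => ?_) (fun y hy => ?_)
  · rw [interior_Ioi] at hy
    exact (hasDerivAt_rpow_mul_besselK hy ν).hasDerivWithinAt
  · rw [interior_Ioi, mem_Ioi] at hy
    have := besselK_pos hy (ν - 1)
    have : 0 < y ^ ν * besselK (ν - 1) y := by positivity
    linarith

theorem antitoneOn_exp_mul_rpow_mul_besselK {a b ν : ℝ} (hν : 1 / 2 ≤ ν) (ha0 : 0 ≤ a)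
    (ha1 : a < 1) (hb0 : 0 < b) (hb : a * (2 * ν - 1) ≤ b * (1 - a ^ 2)) :
    AntitoneOn (fun y => Real.exp (a * y) * (y ^ ν * besselK ν y)) (Ici b) := by
  refine antitoneOn_of_hasDerivWithinAt_nonpos (convex_Ici b)
    (fun y hy => (hasDerivAt_exp_mul_rpow_mul_besselK
      (hb0.trans_le hy) a ν).continuousAt.continuousWithinAt)
    (f' := fun y => Real.exp (a * y) * y ^ ν * (a * besselK ν y - besselK (ν - 1) y))
    (fun y hy => ?_) (fun y hy => ?_)
  · rw [interior_Ici] at hy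
    exact (hasDerivAt_exp_mul_rpow_mul_besselK (hb0.trans hy) a ν).hasDerivWithinAt
  · rw [interior_Ici, mem_Ioi] at hy
    have hy0 := hb0.trans hy
    have h1 : 0 ≤ 1 - a ^ 2 := by nlinarith
    have := mul_besselK_le_besselK_sub_one hν hy0 (hb.trans (by gcongr))
    exact mul_nonpos_of_nonneg_of_nonpos (by positivity) (by linarith)

theorem monotoneOn_exp_mul_rpow_mul_besselK {a b ν : ℝ} (hν : 1 ≤ ν) (ha0 : 0 ≤ a)
    (ha1 : a < 1) (hb : b * (1 - a ^ 2) ≤ 2 * a * (ν - 1)) :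
    MonotoneOn (fun y => Real.exp (a * y) * (y ^ ν * besselK ν y)) (Ioc 0 b) := by
  refine monotoneOn_of_hasDerivWithinAt_nonneg (convex_Ioc 0 b)
    (fun y hy => (hasDerivAt_exp_mul_rpow_mul_besselK
      hy.1 a ν).continuousAt.continuousWithinAt)
    (f' := fun y => Real.exp (a * y) * y ^ ν * (a * besselK ν y - besselK (ν - 1) y))
    (fun y hy => ?_) (fun y hy => ?_)
  · rw [interior_Ioc] at hy
    exact (hasDerivAt_exp_mul_rpow_mul_besselK hy.1 a ν).hasDerivWithinAt
  · rw [interior_Ioc] at hy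
    have hy0 := hy.1
    have h1 : 0 ≤ 1 - a ^ 2 := by nlinarith
    have := besselK_sub_one_le_mul_besselK hν ha0 hy0 (le_trans (by gcongr; exact hy.2.le) hb)
    exact mul_nonneg (by positivity) (by linarith)

/-! ### Behaviour of y^ν K_ν(y) at the origin -/

theorem integral_comp_exp {E : Type*} [NormedAddCommGroup E] [NormedSpace ℝ E] (g : ℝ → E) :
    ∫ x : ℝ, Real.exp x • g (Real.exp x) = ∫ y in Ioi (0 : ℝ), g y := by
  rw [← Real.range_exp, ← image_univ,
    integral_image_eq_integral_abs_deriv_smul MeasurableSet.univ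
      (fun x _ => (Real.hasDerivAt_exp x).hasDerivWithinAt) Real.exp_injective.injOn]
  simp

theorem two_mul_besselK_eq_integral {y : ℝ} (hy : 0 < y) (ν : ℝ) :
    2 * besselK ν y = ∫ t : ℝ, Real.exp (-y * Real.cosh t) * Real.exp (ν * t) := by
  have h := integrable_exp_neg_mul_cosh_mul_exp hy ν
  have hneg : ∫ t in Iic (0 : ℝ), Real.exp (-y * Real.cosh t) * Real.exp (ν * t) =
      ∫ t in Ioi (0 : ℝ), Real.exp (-y * Real.cosh t) * Real.exp (-ν * t) := by
    have := integral_comp_neg_Ioi (0 : ℝ)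
      (fun t => Real.exp (-y * Real.cosh t) * Real.exp (ν * t))
    rw [neg_zero] at this
    rw [← this]
    simp
  rw [← intervalIntegral.integral_Iic_add_Ioi h.integrableOn h.integrableOn (b := 0), hneg,
    ← integral_add (integrable_exp_neg_mul_cosh_mul_exp hy (-ν)).integrableOn h.integrableOn,
    besselK, ← integral_const_mul]
  congr 1 with t
  rw [Real.cosh_eq (ν * t), neg_mul ν]
  ring

/-- Substitute x = e^t, then x = 2u/y. The integrand is now dominated by that of Γ(ν), which gives
the limit at 0 when ν > 0. -/
theorem rpow_mul_besselK_eq_integral {y : ℝ} (hy : 0 < y) (ν : ℝ) :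
    y ^ ν * besselK ν y = 2 ^ (ν - 1) *
      ∫ u in Ioi (0 : ℝ), Real.exp (-u - y ^ 2 / (4 * u)) * u ^ (ν - 1) := by
  have h1 : 2 * besselK ν y =
      ∫ x in Ioi (0 : ℝ), Real.exp (-y * ((x + x⁻¹) / 2)) * x ^ (ν - 1) := by
    rw [two_mul_besselK_eq_integral hy, ← integral_comp_exp]
    congr 1 with t
    have e : Real.exp (ν * t) = Real.exp t * Real.exp (t * (ν - 1)) := by
      rw [← Real.exp_add]
      ring_nf
    rw [smul_eq_mul, Real.cosh_eq, ← Real.exp_neg, ← Real.exp_mul, e]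
    ring
  have h2 := integral_comp_mul_left_Ioi
    (fun x : ℝ => Real.exp (-y * ((x + x⁻¹) / 2)) * x ^ (ν - 1)) 0 (b := 2 / y) (by positivity)
  rw [mul_zero, ← h1] at h2
  have h3 : ∫ u in Ioi (0 : ℝ), Real.exp (-y * ((2 / y * u + (2 / y * u)⁻¹) / 2)) *
      (2 / y * u) ^ (ν - 1) = (2 / y) ^ (ν - 1) *
        ∫ u in Ioi (0 : ℝ), Real.exp (-u - y ^ 2 / (4 * u)) * u ^ (ν - 1) := by
    rw [← integral_const_mul]
    refine setIntegral_congr_fun measurableSet_Ioi fun u hu => ?_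
    rw [mem_Ioi] at hu
    rw [Real.mul_rpow (by positivity) hu.le]
    have : -y * ((2 / y * u + (2 / y * u)⁻¹) / 2) = -u - y ^ 2 / (4 * u) := by
      field_simp
      ring
    rw [this]
    ring
  rw [h3, smul_eq_mul] at h2
  generalize ∫ u in Ioi (0 : ℝ), Real.exp (-u - y ^ 2 / (4 * u)) * u ^ (ν - 1) = J at h2 ⊢
  have e1 : (2 / y) ^ (ν - 1) = 2 ^ (ν - 1) / y ^ (ν - 1) := Real.div_rpow two_pos.le hy.le _
  have e2 : y ^ ν = y ^ (ν - 1) * y := by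
    rw [← Real.rpow_add_one hy.ne', sub_add_cancel]
  have hyp : 0 < y ^ (ν - 1) := by positivity
  rw [e1] at h2
  rw [e2]
  field_simp at h2 ⊢
  linarith

theorem tendsto_rpow_mul_besselK {ν : ℝ} (hν : 0 < ν) :
    Tendsto (fun y => y ^ ν * besselK ν y) (𝓝[>] 0) (𝓝 (2 ^ (ν - 1) * Real.Gamma ν)) := by
  have h : Tendsto (fun y : ℝ => ∫ u in Ioi (0 : ℝ),
      Real.exp (-u - y ^ 2 / (4 * u)) * u ^ (ν - 1)) (𝓝 0) (𝓝 (Real.Gamma ν)) := by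
    rw [Real.Gamma_eq_integral hν]
    refine tendsto_integral_filter_of_dominated_convergence
      (fun u => Real.exp (-u) * u ^ (ν - 1)) (Eventually.of_forall fun y => ?_)
      (Eventually.of_forall fun y => ?_) (Real.GammaIntegral_convergent hν)
      (ae_of_all _ fun u => ?_)
    · exact Measurable.aestronglyMeasurable (by fun_prop)
    · filter_upwards [ae_restrict_mem measurableSet_Ioi] with u hu
      rw [mem_Ioi] at hu
      rw [Real.norm_of_nonneg (by positivity)]
      gcongr
      have : 0 ≤ y ^ 2 / (4 * u) := by positivity
      linarith
    · have hc : Continuous fun y : ℝ => Real.exp (-u - y ^ 2 / (4 * u)) * u ^ (ν - 1) := by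
        fun_prop
      simpa using hc.tendsto 0
  refine ((h.mono_left nhdsWithin_le_nhds).const_mul _).congr' ?_
  filter_upwards [self_mem_nhdsWithin] with y hy
  exact (rpow_mul_besselK_eq_integral hy ν).symm

theorem rpow_mul_besselK_lt {y ν : ℝ} (hν : 0 < ν) (hy : 0 < y) :
    y ^ ν * besselK ν y < 2 ^ (ν - 1) * Real.Gamma ν := by
  -- Passing through y/2 keeps the inequality strict after the limit.
  have hy2 := half_pos hy
  refine (strictAntiOn_rpow_mul_besselK ν hy2 hy (half_lt_self hy)).trans_le
    (ge_of_tendsto (tendsto_rpow_mul_besselK hν) ?_)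
  filter_upwards [Ioo_mem_nhdsGT hy2] with w hw
  exact (strictAntiOn_rpow_mul_besselK ν).antitoneOn hw.1 hy2 hw.2.le

/-! ### Bounds for e^{ay} y^ν K_ν(y) -/

theorem exp_mul_rpow_mul_besselK_le {a b y ν : ℝ} (hν : 1 / 2 < ν) (ha0 : 0 ≤ a) (ha1 : a < 1)
    (hb : b * (1 - a ^ 2) = a * (2 * ν - 1)) (hy : 0 < y) :
    Real.exp (a * y) * (y ^ ν * besselK ν y) ≤
      Real.exp (a * b) * (2 ^ (ν - 1) * Real.Gamma ν) := by
  have hν0 : 0 < ν := by linarith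
  have hG := Real.Gamma_pos_of_pos hν0
  have below : ∀ w, 0 < w → w ≤ b → Real.exp (a * w) * (w ^ ν * besselK ν w) ≤
      Real.exp (a * b) * (2 ^ (ν - 1) * Real.Gamma ν) := by
    intro w hw hwb
    have := besselK_pos hw ν
    exact mul_le_mul (by gcongr) (rpow_mul_besselK_lt hν0 hw).le (by positivity) (by positivity)
  rcases le_or_gt y b with h | h
  · exact below y hy h
  -- For a = 0 the threshold b is 0, so the antitone lemma, which needs b > 0, is unavailable.
  rcases ha0.eq_or_lt with rfl | ha
  · simpa using (rpow_mul_besselK_lt hν0 hy).le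
  · have h1 : 0 < 1 - a ^ 2 := by nlinarith
    have hb0 : 0 < b :=
      pos_of_mul_pos_left (hb ▸ mul_pos ha (by linarith)) h1.le
    exact (antitoneOn_exp_mul_rpow_mul_besselK hν.le ha0 ha1 hb0 hb.ge self_mem_Ici h.le h.le).trans
      (below b hb0 le_rfl)

section UpperBound

variable {a b b' ν : ℝ}

/-- Covers x = μ in (2): the limit at 0 is at most the value at b', and strictness comes from
e^{ab'} < e^{ab}. -/
theorem gamma_lt_exp_mul_rpow_mul_besselK (hν : 1 < ν) (ha0 : 0 < a) (ha1 : a < 1)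
    (hb' : b' * (1 - a ^ 2) = 2 * a * (ν - 1)) (hb'0 : 0 < b') (hlt : b' < b) :
    2 ^ (ν - 1) * Real.Gamma ν < Real.exp (a * b) * (b' ^ ν * besselK ν b') := by
  have hK := besselK_pos hb'0 ν
  have h1 : 2 ^ (ν - 1) * Real.Gamma ν ≤ Real.exp (a * b') * (b' ^ ν * besselK ν b') := by
    have hlim : Tendsto (fun y => Real.exp (a * y) * (y ^ ν * besselK ν y)) (𝓝[>] 0)
        (𝓝 (2 ^ (ν - 1) * Real.Gamma ν)) := by
      have hc : Continuous fun y : ℝ => Real.exp (a * y) := by fun_prop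
      have h := ((hc.tendsto 0).mono_left nhdsWithin_le_nhds).mul
        (tendsto_rpow_mul_besselK (ν := ν) (by linarith))
      simpa using h
    refine le_of_tendsto hlim ?_
    filter_upwards [Ioo_mem_nhdsGT hb'0] with w hw
    exact monotoneOn_exp_mul_rpow_mul_besselK hν.le ha0.le ha1 hb'.le ⟨hw.1, hw.2.le⟩
      ⟨hb'0, le_rfl⟩ hw.2.le
  refine h1.trans_lt ?_
  gcongr

theorem exp_mul_rpow_mul_besselK_lt {y : ℝ} (hν : 1 < ν) (ha0 : 0 < a) (ha1 : a < 1)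
    (hb : b * (1 - a ^ 2) = a * (2 * ν - 1)) (hb' : b' * (1 - a ^ 2) = 2 * a * (ν - 1))
    (hb'0 : 0 < b') (hlt : b' < b) (hy : 0 < y) :
    Real.exp (a * y) * (y ^ ν * besselK ν y) < Real.exp (a * b) * (b' ^ ν * besselK ν b') := by
  have hK := besselK_pos hb'0 ν
  have middle : ∀ w, b' < w → w ≤ b → Real.exp (a * w) * (w ^ ν * besselK ν w) <
      Real.exp (a * b) * (b' ^ ν * besselK ν b') := by
    intro w hw hwb
    have hw0 := hb'0.trans hw
    have := besselK_pos hw0 ν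
    have h := strictAntiOn_rpow_mul_besselK ν hb'0 hw0 hw
    simp only at h
    exact mul_lt_mul' (by gcongr) h (by positivity) (by positivity)
  rcases le_or_gt y b' with h | h
  · refine (monotoneOn_exp_mul_rpow_mul_besselK hν.le ha0.le ha1 hb'.le ⟨hy, h⟩
      ⟨hb'0, le_rfl⟩ h).trans_lt ?_
    simp only
    gcongr
  rcases le_or_gt y b with h2 | h2
  · exact middle y h h2
  · exact (antitoneOn_exp_mul_rpow_mul_besselK (by linarith) ha0.le ha1 (hb'0.trans hlt) hb.ge
      self_mem_Ici h2.le h2.le).trans_lt (middle b hlt le_rfl)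

end UpperBound

/-! ### The density in the rescaled variable -/

theorem div_rpow_mul_besselK_eq {s σ w : ℝ} (hs : 0 < s) (hσ : 0 < σ) (hw : 0 ≤ w) (ν : ℝ) :
    (w / (2 * s)) ^ ν * besselK ν (s / σ ^ 2 * w) =
      (σ ^ 2 / (2 * s ^ 2)) ^ ν * ((s / σ ^ 2 * w) ^ ν * besselK ν (s / σ ^ 2 * w)) := by
  rw [← mul_assoc, ← Real.mul_rpow (by positivity) (by positivity)]
  congr 2
  field_simp

theorem vgFormula_eq {r θ σ μ x : ℝ} (hσ : 0 < σ) :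
    vgFormula r θ σ μ x = 1 / (σ * Real.sqrt Real.pi * Real.Gamma (r / 2)) *
      (σ ^ 2 / (2 * Real.sqrt (θ ^ 2 + σ ^ 2) ^ 2)) ^ ((r - 1) / 2) *
      (Real.exp (θ / σ ^ 2 * (x - μ)) *
        ((Real.sqrt (θ ^ 2 + σ ^ 2) / σ ^ 2 * |x - μ|) ^ ((r - 1) / 2) *
          besselK ((r - 1) / 2) (Real.sqrt (θ ^ 2 + σ ^ 2) / σ ^ 2 * |x - μ|))) := by
  have hs : 0 < Real.sqrt (θ ^ 2 + σ ^ 2) := Real.sqrt_pos.2 (by positivity)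
  rw [vgFormula, mul_assoc _ (_ ^ _) (besselK _ _),
    div_rpow_mul_besselK_eq hs hσ (abs_nonneg (x - μ))]
  ring

theorem vgDensity_self {r θ σ μ : ℝ} (hr : 1 < r) (hσ : 0 < σ) :
    vgDensity r θ σ μ μ = 1 / (σ * Real.sqrt Real.pi * Real.Gamma (r / 2)) *
      (σ ^ 2 / (2 * Real.sqrt (θ ^ 2 + σ ^ 2) ^ 2)) ^ ((r - 1) / 2) *
      (2 ^ ((r - 1) / 2 - 1) * Real.Gamma ((r - 1) / 2)) := by
  have hs : 0 < Real.sqrt (θ ^ 2 + σ ^ 2) := Real.sqrt_pos.2 (by positivity)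
  rw [vgDensity, if_pos rfl]
  refine Tendsto.limUnder_eq ?_
  have he : Tendsto (fun x => Real.exp (θ / σ ^ 2 * (x - μ))) (𝓝[≠] μ) (𝓝 1) := by
    have hc : Continuous fun x => Real.exp (θ / σ ^ 2 * (x - μ)) := by fun_prop
    simpa using (hc.tendsto μ).mono_left nhdsWithin_le_nhds
  have hy : Tendsto (fun x => Real.sqrt (θ ^ 2 + σ ^ 2) / σ ^ 2 * |x - μ|) (𝓝[≠] μ) (𝓝[>] 0) := by
    refine tendsto_nhdsWithin_iff.2 ⟨?_, ?_⟩
    · have hc : Continuous fun x => Real.sqrt (θ ^ 2 + σ ^ 2) / σ ^ 2 * |x - μ| := by fun_prop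
      simpa using (hc.tendsto μ).mono_left nhdsWithin_le_nhds
    · filter_upwards [self_mem_nhdsWithin] with x hx
      have : 0 < |x - μ| := abs_pos.2 (sub_ne_zero.2 hx)
      exact mem_Ioi.2 (by positivity)
  have h := (he.mul ((tendsto_rpow_mul_besselK (ν := (r - 1) / 2) (by linarith)).comp hy)).const_mul
    (1 / (σ * Real.sqrt Real.pi * Real.Gamma (r / 2)) *
      (σ ^ 2 / (2 * Real.sqrt (θ ^ 2 + σ ^ 2) ^ 2)) ^ ((r - 1) / 2))
  rw [one_mul] at h
  exact h.congr fun x => (vgFormula_eq hσ).symm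

theorem vgFormula_le_exp_abs {r θ σ μ x : ℝ} (hr : 1 < r) (hσ : 0 < σ) (hx : x ≠ μ) :
    vgFormula r θ σ μ x ≤ 1 / (σ * Real.sqrt Real.pi * Real.Gamma (r / 2)) *
      (σ ^ 2 / (2 * Real.sqrt (θ ^ 2 + σ ^ 2) ^ 2)) ^ ((r - 1) / 2) *
      (Real.exp (|θ| / Real.sqrt (θ ^ 2 + σ ^ 2) *
          (Real.sqrt (θ ^ 2 + σ ^ 2) / σ ^ 2 * |x - μ|)) *
        ((Real.sqrt (θ ^ 2 + σ ^ 2) / σ ^ 2 * |x - μ|) ^ ((r - 1) / 2) *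
          besselK ((r - 1) / 2) (Real.sqrt (θ ^ 2 + σ ^ 2) / σ ^ 2 * |x - μ|))) := by
  have hs : 0 < Real.sqrt (θ ^ 2 + σ ^ 2) := Real.sqrt_pos.2 (by positivity)
  have hG : 0 < Real.Gamma (r / 2) := Real.Gamma_pos_of_pos (by linarith)
  have hz : 0 < |x - μ| := abs_pos.2 (sub_ne_zero.2 hx)
  have hK := besselK_pos (y := Real.sqrt (θ ^ 2 + σ ^ 2) / σ ^ 2 * |x - μ|) (by positivity)
    ((r - 1) / 2)
  rw [vgFormula_eq hσ]
  refine mul_le_mul_of_nonneg_left (mul_le_mul_of_nonneg_right (Real.exp_le_exp.2 ?_)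
    (by positivity)) (by positivity)
  have h := le_abs_self (θ * (x - μ))
  rw [abs_mul] at h
  have e1 : θ / σ ^ 2 * (x - μ) = θ * (x - μ) / σ ^ 2 := by ring
  have e2 : |θ| / Real.sqrt (θ ^ 2 + σ ^ 2) * (Real.sqrt (θ ^ 2 + σ ^ 2) / σ ^ 2 * |x - μ|) =
      |θ| * |x - μ| / σ ^ 2 := by field_simp
  rw [e1, e2]
  gcongr

/-! ### The two bounds and their comparison -/

theorem proposition2p1 (r θ σ μ : ℝ) (hr : 2 < r) (hσ : 0 < σ) :
    (∀ x : ℝ, vgDensity r θ σ μ x ≤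
      Real.Gamma ((r - 1) / 2) / (2 * σ * Real.sqrt Real.pi * Real.Gamma (r / 2))
        * (σ ^ 2 / (θ ^ 2 + σ ^ 2)) ^ ((r - 1) / 2)
        * Real.exp (θ ^ 2 / σ ^ 2 * (r - 2))) ∧
    (3 < r → θ ≠ 0 →
      (∀ x : ℝ, vgDensity r θ σ μ x <
        1 / (σ * Real.sqrt Real.pi * Real.Gamma (r / 2))
          * Real.exp (θ ^ 2 / σ ^ 2 * (r - 2))
          * (|θ| * (r - 3) / (2 * Real.sqrt (θ ^ 2 + σ ^ 2))) ^ ((r - 1) / 2)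
          * besselK ((r - 1) / 2) (|θ| * Real.sqrt (θ ^ 2 + σ ^ 2) / σ ^ 2 * (r - 3))) ∧
      1 / (σ * Real.sqrt Real.pi * Real.Gamma (r / 2))
          * Real.exp (θ ^ 2 / σ ^ 2 * (r - 2))
          * (|θ| * (r - 3) / (2 * Real.sqrt (θ ^ 2 + σ ^ 2))) ^ ((r - 1) / 2)
          * besselK ((r - 1) / 2) (|θ| * Real.sqrt (θ ^ 2 + σ ^ 2) / σ ^ 2 * (r - 3)) <
        Real.Gamma ((r - 1) / 2) / (2 * σ * Real.sqrt Real.pi * Real.Gamma (r / 2))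
          * (σ ^ 2 / (θ ^ 2 + σ ^ 2)) ^ ((r - 1) / 2)
          * Real.exp (θ ^ 2 / σ ^ 2 * (r - 2))) := by
  have hs : 0 < Real.sqrt (θ ^ 2 + σ ^ 2) := Real.sqrt_pos.2 (by positivity)
  have hs2 : Real.sqrt (θ ^ 2 + σ ^ 2) ^ 2 = θ ^ 2 + σ ^ 2 := Real.sq_sqrt (by positivity)
  have hG : 0 < Real.Gamma (r / 2) := Real.Gamma_pos_of_pos (by linarith)
  have hdens (x : ℝ) (hx : x ≠ μ) := vgFormula_le_exp_abs (r := r) (θ := θ) (by linarith) hσ hx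
  have hself := vgDensity_self (r := r) (θ := θ) (μ := μ) (by linarith) hσ
  have hform (x : ℝ) (hx : x ≠ μ) : vgDensity r θ σ μ x = vgFormula r θ σ μ x := if_neg hx
  have hrhs : Real.Gamma ((r - 1) / 2) / (2 * σ * Real.sqrt Real.pi * Real.Gamma (r / 2))
        * (σ ^ 2 / (θ ^ 2 + σ ^ 2)) ^ ((r - 1) / 2)
        * Real.exp (θ ^ 2 / σ ^ 2 * (r - 2)) =
      1 / (σ * Real.sqrt Real.pi * Real.Gamma (r / 2)) *
      (σ ^ 2 / (2 * Real.sqrt (θ ^ 2 + σ ^ 2) ^ 2)) ^ ((r - 1) / 2) *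
      (Real.exp (θ ^ 2 / σ ^ 2 * (r - 2)) *
        (2 ^ ((r - 1) / 2 - 1) * Real.Gamma ((r - 1) / 2))) := by
    have e : σ ^ 2 / (2 * Real.sqrt (θ ^ 2 + σ ^ 2) ^ 2) = σ ^ 2 / (θ ^ 2 + σ ^ 2) / 2 := by
      rw [hs2]
      field_simp
    rw [e, Real.div_rpow (by positivity) two_pos.le, Real.rpow_sub_one two_ne_zero]
    field_simp
  set s := Real.sqrt (θ ^ 2 + σ ^ 2) with hs_def
  set ν := (r - 1) / 2 with hν
  set a := |θ| / s with ha
  set C := 1 / (σ * Real.sqrt Real.pi * Real.Gamma (r / 2)) * (σ ^ 2 / (2 * s ^ 2)) ^ ν with hC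
  have hC0 : 0 < C := by positivity
  have ha0 : 0 ≤ a := by positivity
  have ha2 : 1 - a ^ 2 = σ ^ 2 / s ^ 2 := by
    rw [ha, div_pow, sq_abs, eq_div_iff (by positivity), sub_mul, div_mul_cancel₀ _ (by positivity),
      hs2]
    ring
  have ha1 : a < 1 := by
    have : 0 < σ ^ 2 / s ^ 2 := by positivity
    nlinarith
  have hab : a * (|θ| * s / σ ^ 2 * (r - 2)) = θ ^ 2 / σ ^ 2 * (r - 2) := by
    rw [← sq_abs θ, ha]
    field_simp
  -- The thresholds b and b' come from 1 - a² = σ²/s², 2ν - 1 = r - 2 and 2(ν - 1) = r - 3.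
  have hb : |θ| * s / σ ^ 2 * (r - 2) * (1 - a ^ 2) = a * (2 * ν - 1) := by
    rw [ha2, ha, hν]
    field_simp
    ring
  have hb' : |θ| * s / σ ^ 2 * (r - 3) * (1 - a ^ 2) = 2 * a * (ν - 1) := by
    rw [ha2, ha, hν]
    field_simp
    ring
  have hν1 : 1 / 2 < ν := by rw [hν]; linarith
  have hΓ : 0 < 2 ^ (ν - 1) * Real.Gamma ν :=
    mul_pos (by positivity) (Real.Gamma_pos_of_pos (by linarith))
  rw [hrhs, ← hab]
  refine ⟨fun x => ?_, fun hr3 hθ => ?_⟩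
  · rcases eq_or_ne x μ with rfl | hx
    · rw [hself]
      refine mul_le_mul_of_nonneg_left ?_ hC0.le
      refine le_mul_of_one_le_left hΓ.le (Real.one_le_exp ?_)
      rw [hab]
      have : 0 ≤ r - 2 := by linarith
      positivity
    · rw [hform x hx]
      refine (hdens x hx).trans ?_
      have hz : 0 < |x - μ| := abs_pos.2 (sub_ne_zero.2 hx)
      exact mul_le_mul_of_nonneg_left
        (exp_mul_rpow_mul_besselK_le hν1 ha0 ha1 hb (by positivity)) hC0.le
  · have hθ0 : 0 < |θ| := abs_pos.2 hθ
    have hr3' : 0 < r - 3 := by linarith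
    have hν2 : 1 < ν := by rw [hν]; linarith
    have hb'0 : 0 < |θ| * s / σ ^ 2 * (r - 3) := by positivity
    have hlt : |θ| * s / σ ^ 2 * (r - 3) < |θ| * s / σ ^ 2 * (r - 2) := by
      gcongr
      norm_num
    have hap : 0 < a := by positivity
    have hrhs2 : 1 / (σ * Real.sqrt Real.pi * Real.Gamma (r / 2))
          * Real.exp (a * (|θ| * s / σ ^ 2 * (r - 2)))
          * (|θ| * (r - 3) / (2 * s)) ^ ν
          * besselK ν (|θ| * s / σ ^ 2 * (r - 3)) =
        C * (Real.exp (a * (|θ| * s / σ ^ 2 * (r - 2))) *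
          ((|θ| * s / σ ^ 2 * (r - 3)) ^ ν * besselK ν (|θ| * s / σ ^ 2 * (r - 3)))) := by
      have h := div_rpow_mul_besselK_eq hs hσ (w := |θ| * (r - 3)) (by positivity) ν
      have e : s / σ ^ 2 * (|θ| * (r - 3)) = |θ| * s / σ ^ 2 * (r - 3) := by ring
      rw [e] at h
      rw [mul_assoc _ (_ ^ _) (besselK _ _), h, hC]
      ring
    rw [hrhs2]
    refine ⟨fun x => ?_, ?_⟩
    · rcases eq_or_ne x μ with rfl | hx
      · rw [hself]
        exact mul_lt_mul_of_pos_left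
          (gamma_lt_exp_mul_rpow_mul_besselK hν2 hap ha1 hb' hb'0 hlt) hC0
      · rw [hform x hx]
        refine (hdens x hx).trans_lt ?_
        have hz : 0 < |x - μ| := abs_pos.2 (sub_ne_zero.2 hx)
        exact mul_lt_mul_of_pos_left
          (exp_mul_rpow_mul_besselK_lt hν2 hap ha1 hb hb' hb'0 hlt (by positivity)) hC0
    · gcongr C * (_ * ?_)
      exact rpow_mul_besselK_lt (by linarith) hb'0
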